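/- Let $k\ge 0$ be an integer, and for $g:[0,\infty)\to\mathbb R$ write $\mathcal L g(z)=\int_0^\infty g(T)e^{-zT}\,dT$. Let $f:[0,\infty)\to[0,\infty)$ be differentiable (one-sidedly at $0$), and suppose $f'=\alpha_+-\alpha_-$ with functions $\alpha_\pm:[0,\infty)\to[0,\infty)$. Suppose that each of the Laplace transforms $\mathcal L f(z)$, $\mathcal L\alpha_+(z)$, $\mathcal L\alpha_-(z)$ converges for $\operatorname{Re}(z)>0$ and extends to a meromorphic function on an open set containing the closed half-plane $H=\{z\in\mathbb C:\operatorname{Re}(z)\ge 0\}$; denote the extensions by the same symbols. Suppose that in $H$ the function $\mathcal L f$ has a unique pole, which is at $z=0$ and of order $k+1$, and that in $H$ each of $\mathcal L\alpha_+$ and $\mathcal L\alpha_-$ either has a unique pole, which is at $z=0$ and of order at most $k+1$, or is holomorphic. If $\lim_{z\to 0}z^{k+1}\mathcal L f(z)=C$ with $C>0$, then $$\lim_{T\to\infty}\frac{f(T)}{T^k}=\frac{C}{k!}.$$ -/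

import Mathlib

open Filter Set Topology MeasureTheory

/-- The integral `∫₀^∞ f(T) e^{-zT} dT` converges. For `f ≥ 0` (the only case used) and all `z` with
`Re z > 0`, convergence as an improper integral is the same as this absolute convergence, because
the integrand is nonnegative for real `z` and `|e^{-zT}| = e^{-(Re z) T}`. -/
def LaplaceConvergesAt (f : ℝ → ℝ) (z : ℂ) : Prop :=
  IntegrableOn (fun T : ℝ => (f T : ℂ) * Complex.exp (-z * (T : ℂ))) (Ioi 0)

/-- The Laplace transform `ℒ f (z) = ∫₀^∞ f(T) e^{-zT} dT`. -/
noncomputable def laplaceTransform (f : ℝ → ℝ) (z : ℂ) : ℂ :=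
  ∫ T in Ioi (0 : ℝ), (f T : ℂ) * Complex.exp (-z * (T : ℂ))

/-- `ℒ f` converges on the open right half-plane, and `F` is a meromorphic extension of it to an
open set that contains the closed right half-plane. -/
def IsMeromorphicLaplaceExtension (f : ℝ → ℝ) (F : ℂ → ℂ) : Prop :=
  (∀ z : ℂ, 0 < z.re → LaplaceConvergesAt f z) ∧
    (∃ U : Set ℂ, IsOpen U ∧ {z : ℂ | 0 ≤ z.re} ⊆ U ∧ MeromorphicOn F U) ∧
    ∀ z : ℂ, 0 < z.re → F z = laplaceTransform f z

/-- `F` has no pole in the closed right half-plane except possibly at `0`. A pole is a point of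
negative order, so removable singularities are not poles. -/
def NoPoleAwayFromZero (F : ℂ → ℂ) : Prop :=
  ∀ z : ℂ, 0 ≤ z.re → z ≠ 0 → 0 ≤ meromorphicOrderAt F z

/-- `F` has exactly one pole in the closed right half-plane, at `0`, and its order is `m`
(meant for `1 ≤ m`). -/
def HasUniquePoleAtZero (F : ℂ → ℂ) (m : ℕ) : Prop :=
  meromorphicOrderAt F 0 = ((-(m : ℤ) : ℤ) : WithTop ℤ) ∧ NoPoleAwayFromZero F

/-- In the closed right half-plane `F` either has exactly one pole, at `0` and of order at
most `m`, or has no pole at all (is holomorphic there, up to removable singularities). -/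
def HasAtMostPoleAtZero (F : ℂ → ℂ) (m : ℕ) : Prop :=
  ((-(m : ℤ) : ℤ) : WithTop ℤ) ≤ meromorphicOrderAt F 0 ∧ NoPoleAwayFromZero F

/-! This is a Wiener–Ikehara argument with polynomial growth. The principal part of a transform at
`0` is itself the transform of a polynomial of degree at most `k`; subtracting that polynomial
leaves a function `h` whose transform `G` is continuous up to the imaginary axis
(`exists_hasLaplaceBoundary_sub_polynomial`). Take a kernel `K = 𝓕 φ ≥ 0` with `φ` of compact
support. By Fubini the average of `h` against `K (T - x)`, damped by `e^{-εT}`, is a Fourier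
integral of `G` on the line `Re z = ε`. As `ε → 0` it becomes the Fourier transform at `-x` of `φ(t)
G(2πit)`, which is bounded in `x` and tends to `0` by Riemann–Lebesgue.

For `α₊` and `α₋`, positivity turns this into an upper bound `N δ (1 + x)^k` on windows of length
`δ` far to the right, with `N` independent of `δ` (`exists_hasBoundedWindows`). Hence `f`, and also
`g = f - R` with `R` the polynomial belonging to `f`, oscillates slowly.

Finally, average `g` over a kernel of width `δ`. The average tends to `0`; it differs from `g x`
times the kernel mass by `O(δ² (1 + x)^k)`, while the mass is at least `c₀ δ`. So `g x` is
eventually `O(δ) (1 + x)^k` for every small `δ` (`HasLaplaceBoundary.eventually_norm_le`), and `f`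
is asymptotic to the leading term of `R`, whose coefficient is `C / k!`. -/

open scoped FourierTransform ContDiff

/-! ### Band-limited kernels -/

/-- A nonnegative kernel with all moments finite which is the Fourier transform of a continuous
compactly supported function. -/
structure IsBandLimitedKernel (φ : ℝ → ℂ) (K : ℝ → ℝ) : Prop where
  continuous : Continuous φ
  compactSupport : HasCompactSupport φ
  fourier_eq : ∀ u, 𝓕 φ u = (K u : ℂ)
  nonneg : ∀ u, 0 ≤ K u
  moments : ∀ n : ℕ, Integrable fun u => (1 + |u|) ^ n * K u

namespace IsBandLimitedKernel

variable {φ : ℝ → ℂ} {K : ℝ → ℝ}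

theorem integrable_symbol (hK : IsBandLimitedKernel φ K) : Integrable φ :=
  hK.continuous.integrable_of_hasCompactSupport hK.compactSupport

theorem integrable (hK : IsBandLimitedKernel φ K) : Integrable K := by
  simpa using hK.moments 0

theorem kernel_continuous (hK : IsBandLimitedKernel φ K) : Continuous K := by
  have h : Continuous (𝓕 φ) :=
    VectorFourier.fourierIntegral_continuous Real.continuous_fourierChar
      (by exact continuous_inner) hK.integrable_symbol
  have h2 : K = fun u => (𝓕 φ u).re := by
    ext u; simp [hK.fourier_eq]
  rw [h2]
  exact Complex.continuous_re.comp h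

theorem kernel_le (hK : IsBandLimitedKernel φ K) (u : ℝ) : K u ≤ ∫ t, ‖φ t‖ := by
  have h := VectorFourier.norm_fourierIntegral_le_integral_norm Real.fourierChar volume
    (innerₗ ℝ) φ u
  have h2 : ‖𝓕 φ u‖ ≤ ∫ t, ‖φ t‖ := h
  rw [hK.fourier_eq, Complex.norm_real, Real.norm_of_nonneg (hK.nonneg u)] at h2
  exact h2

theorem integral_symbol_mul_exp (hK : IsBandLimitedKernel φ K) (u : ℝ) :
    ∫ t, φ t * Complex.exp (-(2 * Real.pi * t * u : ℝ) * Complex.I) = K u := by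
  rw [← hK.fourier_eq, Real.fourier_real_eq_integral_exp_smul]
  congr 1
  ext t
  rw [smul_eq_mul, mul_comm]
  congr 2
  push_cast
  ring

/-- Dilation localises the kernel to width `1 / s` and stretches the support of the symbol by `s`.
This is harmless because boundary values are available on the whole imaginary axis. -/
theorem scale (hK : IsBandLimitedKernel φ K) {s : ℝ} (hs : 0 < s) :
    IsBandLimitedKernel (fun t => (s : ℂ)⁻¹ * φ (s⁻¹ * t)) (fun u => K (s * u)) where
  continuous := continuous_const.mul (hK.continuous.comp (continuous_const.mul continuous_id))
  compactSupport := by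
    have h : HasCompactSupport fun t => φ (s⁻¹ * t) :=
      hK.compactSupport.comp_homeomorph (Homeomorph.mulLeft₀ s⁻¹ (inv_ne_zero hs.ne'))
    exact h.mul_left
  fourier_eq u := by
    rw [Real.fourier_real_eq_integral_exp_smul, ← hK.integral_symbol_mul_exp]
    have h := Measure.integral_comp_mul_left
      (fun t => φ t * Complex.exp (-(2 * Real.pi * t * (s * u) : ℝ) * Complex.I)) s⁻¹
    rw [inv_inv, abs_of_pos hs] at h
    have h3 : ∀ v : ℂ, v = (s : ℂ)⁻¹ * (s • v) := fun v => by
      have : (s : ℂ) ≠ 0 := by exact_mod_cast hs.ne'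
      simp [this]
    rw [h3 (∫ t, φ t * Complex.exp (-(2 * Real.pi * t * (s * u) : ℝ) * Complex.I)), ← h,
      ← integral_const_mul]
    congr 1
    ext t
    rw [smul_eq_mul, mul_comm, mul_assoc]
    congr 3
    have : (s : ℂ) ≠ 0 := by exact_mod_cast hs.ne'
    push_cast
    field_simp
  nonneg u := hK.nonneg _
  moments n := by
    have h := ((hK.moments n).comp_mul_left' hs.ne').const_mul ((1 + s⁻¹) ^ n)
    refine h.mono' ?_ ?_
    · exact (Continuous.mul (by fun_prop)
        (hK.kernel_continuous.comp (by fun_prop))).aestronglyMeasurable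
    · refine Eventually.of_forall fun u => ?_
      have h0 := hK.nonneg (s * u)
      rw [Real.norm_of_nonneg (by positivity), ← mul_assoc, ← mul_pow]
      gcongr
      rw [abs_mul, abs_of_pos hs]
      have : s⁻¹ * (s * |u|) = |u| := by field_simp
      have h1 := abs_nonneg u
      have : 0 ≤ s⁻¹ := by positivity
      have : 0 ≤ s * |u| := by positivity
      nlinarith

end IsBandLimitedKernel

/-- The symbol is the self-convolution of an even real bump: its transform is the square of a real
Schwartz function, hence nonnegative and rapidly decreasing. At `0` it is the squared mass of the
bump. -/
theorem exists_isBandLimitedKernel_pos_nhds_zero :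
    ∃ φ K, IsBandLimitedKernel φ K ∧ 0 < K 0 := by
  let b : ContDiffBump (0 : ℝ) := ⟨1, 2, one_pos, one_lt_two⟩
  let ψ : ℝ → ℂ := fun x => (b x : ℂ)
  have hψs : HasCompactSupport ψ := b.hasCompactSupport.comp_left (g := fun x : ℝ => (x : ℂ)) rfl
  have hψd : ContDiff ℝ ∞ ψ := Complex.ofRealCLM.contDiff.comp b.contDiff
  have hψc : Continuous ψ := hψd.continuous
  have hψi : Integrable ψ := hψc.integrable_of_hasCompactSupport hψs
  let S : SchwartzMap ℝ ℂ := 𝓕 (hψs.toSchwartzMap hψd)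
  have hS : ∀ u, S u = 𝓕 ψ u := fun u => rfl
  have hreal : ∀ u, 𝓕 ψ u * 𝓕 ψ u = ((‖𝓕 ψ u‖ ^ 2 : ℝ) : ℂ) := by
    intro u
    have hconj : (starRingEnd ℂ) (𝓕 ψ u) = 𝓕 ψ u := by
      rw [Real.fourier_real_eq_integral_exp_smul, ← integral_conj, ← integral_neg_eq_self]
      congr 1
      ext t
      have hb : b (-t) = b t := b.neg t
      simp only [ψ, smul_eq_mul, map_mul, ← Complex.exp_conj, Complex.conj_ofReal, Complex.conj_I,
        hb]
      congr 2
      push_cast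
      ring
    rw [← Complex.normSq_eq_norm_sq, ← Complex.mul_conj, hconj]
  refine ⟨convolution ψ ψ (ContinuousLinearMap.mul ℂ ℂ) volume, fun u => ‖𝓕 ψ u‖ ^ 2,
    ⟨?_, ?_, ?_, ?_, ?_⟩, ?_⟩
  · exact hψs.continuous_convolution_right _ hψi.locallyIntegrable hψc
  · exact hψs.convolution _ hψs
  · intro u
    rw [Real.fourier_mul_convolution_eq hψi hψi, hreal]
  · intro u; positivity
  · intro n
    obtain ⟨B, hB⟩ : ∃ B, ∀ u, ‖𝓕 ψ u‖ ≤ B :=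
      ⟨_, fun u => VectorFourier.norm_fourierIntegral_le_integral_norm Real.fourierChar volume
        (innerₗ ℝ) ψ u⟩
    have h0 := ((S.integrable_pow_mul volume 0).add (S.integrable_pow_mul volume n)).const_mul
      (2 ^ n * B)
    refine h0.mono' ?_ ?_
    · have : Continuous (𝓕 ψ) := S.continuous
      exact Continuous.aestronglyMeasurable (by fun_prop)
    · refine Eventually.of_forall fun u => ?_
      rw [Real.norm_of_nonneg (by positivity)]
      simp only [Pi.add_apply, pow_zero, one_mul, hS, Real.norm_eq_abs]
      have h1 : (1 + |u|) ^ n ≤ 2 ^ n * (1 + |u| ^ n) := by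
        have := add_pow_le (zero_le_one (α := ℝ)) (abs_nonneg u) n
        refine this.trans ?_
        rw [one_pow]
        gcongr
        · norm_num
        · omega
      have h2 := hB u
      have h3 := norm_nonneg (𝓕 ψ u)
      calc (1 + |u|) ^ n * ‖𝓕 ψ u‖ ^ 2 ≤ (2 ^ n * (1 + |u| ^ n)) * (B * ‖𝓕 ψ u‖) := by
            rw [sq]; gcongr
        _ = _ := by ring
  · have h1 : 𝓕 ψ 0 = ((∫ t, b t : ℝ) : ℂ) := by
      rw [Real.fourier_real_eq_integral_exp_smul, ← integral_complex_ofReal]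
      simp [ψ]
    have h2 : 0 < ∫ t, b t := b.integral_pos
    simp only [h1]
    rw [Complex.norm_real]
    exact pow_pos (norm_pos_iff.2 h2.ne') 2

theorem exists_isBandLimitedKernel :
    ∃ φ K, IsBandLimitedKernel φ K ∧ ∃ c > 0, ∀ u ∈ Icc (0 : ℝ) 1, c ≤ K u := by
  obtain ⟨φ, K, hK, h0⟩ := exists_isBandLimitedKernel_pos_nhds_zero
  have h1 : ∀ᶠ u in 𝓝 (0 : ℝ), K 0 / 2 < K u :=
    hK.kernel_continuous.continuousAt.eventually_const_lt (by linarith)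
  obtain ⟨η, hη, h2⟩ := Metric.eventually_nhds_iff.1 h1
  refine ⟨_, _, hK.scale (half_pos hη), K 0 / 2, half_pos h0, fun u hu => (h2 ?_).le⟩
  rw [Real.dist_eq, sub_zero, abs_of_nonneg (mul_nonneg (half_pos hη).le hu.1)]
  nlinarith [hu.2]

/-! ### Laplace transforms and removal of the pole at zero -/

/-- `G` is the Laplace transform of `h` on the open right half-plane and is continuous up to the
imaginary axis. -/
structure HasLaplaceBoundary (h : ℝ → ℂ) (G : ℂ → ℂ) : Prop where
  integrableOn : ∀ z : ℂ, 0 < z.re →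
    IntegrableOn (fun T : ℝ => h T * Complex.exp (-z * (T : ℂ))) (Ioi 0)
  integral_eq : ∀ z : ℂ, 0 < z.re →
    ∫ T in Ioi (0 : ℝ), h T * Complex.exp (-z * (T : ℂ)) = G z
  continuousOn : ContinuousOn G {z : ℂ | 0 ≤ z.re}

theorem norm_exp_neg_mul_ofReal (z : ℂ) (T : ℝ) :
    ‖Complex.exp (-z * (T : ℂ))‖ = Real.exp (-z.re * T) := by
  rw [Complex.norm_exp]; simp

theorem tendsto_pow_mul_exp_neg_mul_ofReal (n : ℕ) {z : ℂ} (hz : 0 < z.re) :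
    Tendsto (fun T : ℝ => (T : ℂ) ^ n * Complex.exp (-z * (T : ℂ))) atTop (𝓝 0) := by
  rw [tendsto_zero_iff_norm_tendsto_zero]
  refine (tendsto_rpow_mul_exp_neg_mul_atTop_nhds_zero n z.re hz).congr' ?_
  filter_upwards [eventually_ge_atTop 0] with T hT
  rw [norm_mul, norm_exp_neg_mul_ofReal, norm_pow, Complex.norm_real, Real.norm_of_nonneg hT,
    Real.rpow_natCast]

theorem integrableOn_pow_mul_exp_neg_mul_ofReal (n : ℕ) {z : ℂ} (hz : 0 < z.re) :
    IntegrableOn (fun T : ℝ => (T : ℂ) ^ n * Complex.exp (-z * (T : ℂ))) (Ioi 0) := by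
  have h := integrableOn_rpow_mul_exp_neg_mul_rpow (p := 1) (s := n) (b := z.re)
    (by have : (0 : ℝ) ≤ n := n.cast_nonneg; linarith) one_pos hz
  refine h.mono' (by fun_prop) ?_
  filter_upwards [ae_restrict_mem measurableSet_Ioi] with T hT
  have hT' : (0 : ℝ) < T := hT
  rw [norm_mul, norm_exp_neg_mul_ofReal, norm_pow, Complex.norm_real, Real.norm_of_nonneg hT'.le,
    Real.rpow_natCast, Real.rpow_one]

theorem integral_pow_mul_exp_neg_mul_ofReal (n : ℕ) {z : ℂ} (hz : 0 < z.re) :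
    ∫ T in Ioi (0 : ℝ), (T : ℂ) ^ n * Complex.exp (-z * (T : ℂ)) =
      (n.factorial : ℂ) / z ^ (n + 1) := by
  have hz0 : z ≠ 0 := by rintro rfl; simp at hz
  have hexp : ∀ T : ℝ, HasDerivAt (fun T : ℝ => Complex.exp (-z * (T : ℂ)))
      (-z * Complex.exp (-z * (T : ℂ))) T := by
    intro T
    have h := ((Complex.ofRealCLM.hasDerivAt (x := T)).const_mul (-z)).cexp
    simpa [mul_comm] using h
  induction n with
  | zero =>
    have h := integral_Ioi_of_hasDerivAt_of_tendsto' (a := (0 : ℝ)) (m := 0)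
      (f := fun T : ℝ => -z⁻¹ * Complex.exp (-z * (T : ℂ)))
      (f' := fun T : ℝ => (T : ℂ) ^ 0 * Complex.exp (-z * (T : ℂ)))
      (fun T _ => by
        have := (hexp T).const_mul (-z⁻¹)
        convert! this using 1
        field_simp)
      (integrableOn_pow_mul_exp_neg_mul_ofReal 0 hz)
      (by simpa using (tendsto_pow_mul_exp_neg_mul_ofReal 0 hz).const_mul (-z⁻¹))
    rw [h]; simp
  | succ n ih =>
    have hI := (integrableOn_pow_mul_exp_neg_mul_ofReal (n + 1) hz).const_mul (-z)
    have hJ := (integrableOn_pow_mul_exp_neg_mul_ofReal n hz).const_mul ((n + 1 : ℕ) : ℂ)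
    have h := integral_Ioi_of_hasDerivAt_of_tendsto' (a := (0 : ℝ)) (m := 0)
      (f := fun T : ℝ => (T : ℂ) ^ (n + 1) * Complex.exp (-z * (T : ℂ)))
      (f' := fun T : ℝ => ((n + 1 : ℕ) : ℂ) * ((T : ℂ) ^ n * Complex.exp (-z * (T : ℂ))) +
        -z * ((T : ℂ) ^ (n + 1) * Complex.exp (-z * (T : ℂ))))
      (fun T _ => by
        have h1 : HasDerivAt (fun T : ℝ => (T : ℂ) ^ (n + 1)) (((n + 1 : ℕ) : ℂ) * (T : ℂ) ^ n) T := by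
          simpa using (Complex.ofRealCLM.hasDerivAt (x := T)).fun_pow (n + 1)
        convert! h1.mul (hexp T) using 1
        ring)
      (hJ.add hI) (tendsto_pow_mul_exp_neg_mul_ofReal (n + 1) hz)
    rw [integral_add hJ hI, integral_const_mul, integral_const_mul, ih] at h
    simp only [Complex.ofReal_zero, ne_eq, Nat.add_eq_zero_iff, one_ne_zero, and_false,
      not_false_eq_true, zero_pow, zero_mul, sub_zero] at h
    rw [Nat.factorial_succ, eq_div_iff (pow_ne_zero _ hz0)]
    generalize ∫ T in Ioi (0 : ℝ), (T : ℂ) ^ (n + 1) * Complex.exp (-z * (T : ℂ)) = I at h ⊢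
    push_cast at h ⊢
    field_simp at h
    linear_combination -h

theorem continuousAt_laplaceTransform {h : ℝ → ℝ}
    (hh : ∀ z : ℂ, 0 < z.re → LaplaceConvergesAt h z) {z : ℂ} (hz : 0 < z.re) :
    ContinuousAt (laplaceTransform h) z := by
  have hz2 : 0 < ((z.re / 2 : ℝ) : ℂ).re := by simpa using hz
  have hI := hh _ hz2
  have hnhds : ∀ᶠ w : ℂ in 𝓝 z, z.re / 2 < w.re :=
    Complex.continuous_re.continuousAt.eventually_const_lt (by linarith)
  refine continuousAt_of_dominated (bound := fun T =>
    ‖(h T : ℂ) * Complex.exp (-((z.re / 2 : ℝ) : ℂ) * (T : ℂ))‖) ?_ ?_ hI.norm ?_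
  · filter_upwards [hnhds] with w hw
    exact (hh w (by linarith)).aestronglyMeasurable
  · filter_upwards [hnhds] with w hw
    filter_upwards [ae_restrict_mem measurableSet_Ioi] with T hT
    have hT' : (0 : ℝ) < T := hT
    rw [norm_mul, norm_mul, norm_exp_neg_mul_ofReal, norm_exp_neg_mul_ofReal, Complex.ofReal_re]
    gcongr
  · exact Eventually.of_forall fun T => by fun_prop

/-- Here `a` is the coefficient of the highest pole term. Once that term is removed, `z` times the
new function tends to `0`, so it has positive order; orders are integers or `⊤`, so dividing by `z`
leaves order at least `0`. -/
theorem exists_sub_div_pow_meromorphicOrderAt_nonneg {F : ℂ → ℂ} (hF : MeromorphicAt F 0) {m : ℕ}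
    (h : 0 ≤ meromorphicOrderAt (fun z => z ^ (m + 1) * F z) 0) :
    ∃ a : ℂ, Tendsto (fun z => z ^ (m + 1) * F z) (𝓝[≠] 0) (𝓝 a) ∧
      0 ≤ meromorphicOrderAt (fun z => z ^ m * (F z - a / z ^ (m + 1))) 0 := by
  have hm : MeromorphicAt (fun z => z ^ (m + 1) * F z) 0 := by fun_prop
  obtain ⟨a, ha⟩ := (tendsto_nhds_iff_meromorphicOrderAt_nonneg hm).2 h
  refine ⟨a, ha, ?_⟩
  have hm' : MeromorphicAt (fun z => z ^ m * (F z - a / z ^ (m + 1))) 0 := by fun_prop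
  have h1 : Tendsto (fun z => z * (z ^ m * (F z - a / z ^ (m + 1)))) (𝓝[≠] 0) (𝓝 0) := by
    have := ha.sub_const a
    rw [sub_self] at this
    refine this.congr' ?_
    filter_upwards [self_mem_nhdsWithin] with z hz
    have hz : z ≠ 0 := hz
    rw [← mul_assoc, ← pow_succ', mul_sub, mul_div_cancel₀ _ (pow_ne_zero _ hz)]
  rw [tendsto_zero_iff_meromorphicOrderAt_pos (by fun_prop),
    fun_meromorphicOrderAt_mul (by fun_prop) hm'] at h1
  have h2 : meromorphicOrderAt (fun z : ℂ => z) 0 = 1 := meromorphicOrderAt_id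
  rw [h2] at h1
  generalize meromorphicOrderAt (fun z => z ^ m * (F z - a / z ^ (m + 1))) 0 = o at h1
  induction o using WithTop.recTopCoe with
  | top => exact le_top
  | coe n =>
    norm_cast at h1 ⊢
    omega

theorem exists_principalPart {m : ℕ} {F : ℂ → ℂ} (hF : MeromorphicAt F 0)
    (h : 0 ≤ meromorphicOrderAt (fun z => z ^ m * F z) 0) :
    ∃ a : ℕ → ℂ,
      0 ≤ meromorphicOrderAt (fun z => F z - ∑ j ∈ Finset.range m, a j / z ^ (j + 1)) 0 := by
  induction m generalizing F with
  | zero => exact ⟨0, by simpa using h⟩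
  | succ m ih =>
    obtain ⟨a, -, ha⟩ := exists_sub_div_pow_meromorphicOrderAt_nonneg hF h
    obtain ⟨b, hb⟩ := ih (F := fun z => F z - a / z ^ (m + 1)) (by fun_prop) ha
    refine ⟨Function.update b m a, ?_⟩
    convert hb using 3 with z
    rw [Finset.sum_range_succ, Function.update_self, sub_sub, add_comm]
    congr 2
    refine Finset.sum_congr rfl fun j hj => ?_
    rw [Function.update_of_ne (Finset.mem_range.1 hj).ne]

/-- Besides the principal part this records that its top coefficient is the limit at `0`, which
later identifies the leading coefficient of the polynomial. -/
theorem exists_principalPart_succ {m : ℕ} {F : ℂ → ℂ} (hF : MeromorphicAt F 0)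
    (h : 0 ≤ meromorphicOrderAt (fun z => z ^ (m + 1) * F z) 0) :
    ∃ a : ℕ → ℂ, Tendsto (fun z => z ^ (m + 1) * F z) (𝓝[≠] 0) (𝓝 (a m)) ∧
      0 ≤ meromorphicOrderAt (fun z => F z - ∑ j ∈ Finset.range (m + 1), a j / z ^ (j + 1)) 0 := by
  obtain ⟨a, ha', ha⟩ := exists_sub_div_pow_meromorphicOrderAt_nonneg hF h
  obtain ⟨b, hb⟩ := exists_principalPart (F := fun z => F z - a / z ^ (m + 1)) (by fun_prop) ha
  refine ⟨Function.update b m a, by simpa using ha', ?_⟩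
  convert hb using 3 with z
  rw [Finset.sum_range_succ, Function.update_self, sub_sub, add_comm]
  congr 2
  refine Finset.sum_congr rfl fun j hj => ?_
  rw [Function.update_of_ne (Finset.mem_range.1 hj).ne]

/-- The term `a j / z ^ (j + 1)` is the transform of `a j / j! * T ^ j`, so removing the principal
part of `F` amounts to subtracting a polynomial from `h`. -/
theorem exists_hasLaplaceBoundary_sub_polynomial {h : ℝ → ℝ} {F : ℂ → ℂ} {k : ℕ}
    (hF : IsMeromorphicLaplaceExtension h F) (hpole : HasAtMostPoleAtZero F (k + 1)) :
    ∃ c : ℕ → ℂ, ∃ G : ℂ → ℂ,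
      HasLaplaceBoundary (fun T => (h T : ℂ) - ∑ j ∈ Finset.range (k + 1), c j * (T : ℂ) ^ j) G ∧
      Tendsto (fun z => z ^ (k + 1) * F z) (𝓝[≠] 0) (𝓝 (c k * k.factorial)) := by
  obtain ⟨hconv, ⟨U, -, hHU, hFU⟩, hFeq⟩ := hF
  have hF0 : MeromorphicAt F 0 := hFU 0 (hHU (by simp))
  have hord : 0 ≤ meromorphicOrderAt (fun z => z ^ (k + 1) * F z) 0 := by
    rw [fun_meromorphicOrderAt_mul (by fun_prop) hF0]
    have h1 : meromorphicOrderAt (fun z : ℂ => z ^ (k + 1)) 0 = ((k + 1 : ℕ) : ℤ) := by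
      rw [fun_meromorphicOrderAt_pow (by fun_prop)]
      have h2 : meromorphicOrderAt (fun z : ℂ => z) 0 = 1 := meromorphicOrderAt_id
      rw [h2, mul_one]; norm_cast
    rw [h1]
    have h3 := hpole.1
    generalize meromorphicOrderAt F 0 = o at h3
    induction o using WithTop.recTopCoe with
    | top => simp
    | coe n =>
      norm_cast at h3 ⊢
      omega
  obtain ⟨a, ha, haord⟩ := exists_principalPart_succ hF0 hord
  set P : ℂ → ℂ := fun z => ∑ j ∈ Finset.range (k + 1), a j / z ^ (j + 1) with hP
  have hPmero : ∀ z, MeromorphicAt P z := fun z => by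
    refine MeromorphicAt.fun_sum fun j => ?_
    fun_prop
  have hPan : ∀ z, z ≠ 0 → AnalyticAt ℂ P z := fun z hz => by
    refine Finset.analyticAt_fun_sum _ fun j _ => ?_
    exact analyticAt_const.fun_div (analyticAt_id.fun_pow _) (pow_ne_zero _ hz)
  have hmero : MeromorphicOn (fun z => F z - P z) U := fun z hz => (hFU z hz).fun_sub (hPmero z)
  -- Only orders of `F` are controlled, so its values at isolated points may be wrong; the normal
  -- form repairs them and is analytic wherever the order is nonnegative.
  set G := toMeromorphicNFOn (fun z => F z - P z) U with hG
  have hGan : ∀ z : ℂ, 0 ≤ z.re → AnalyticAt ℂ G z := by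
    intro z hz
    have hNF := meromorphicNFOn_toMeromorphicNFOn (fun z => F z - P z) U (hHU hz)
    rw [← hNF.meromorphicOrderAt_nonneg_iff_analyticAt,
      meromorphicOrderAt_toMeromorphicNFOn hmero (hHU hz)]
    by_cases h0 : z = 0
    · rw [h0]; exact haord
    · have h1 := hpole.2 z hz h0
      have h2 : 0 ≤ meromorphicOrderAt (fun z => -P z) z :=
        (hPan z h0).fun_neg.meromorphicOrderAt_nonneg
      have h3 := meromorphicOrderAt_add (hFU z (hHU hz)) (hPmero z).fun_neg
      have h4 : (F + fun z => -P z) = fun z => F z - P z := by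
        ext w; simp [sub_eq_add_neg]
      rw [h4] at h3
      exact (le_min h1 h2).trans h3
  -- The normal form agrees with `F - P` only on punctured neighbourhoods; continuity of both sides
  -- gives equality at `z` itself.
  have hGeq : ∀ z : ℂ, 0 < z.re → G z = laplaceTransform h z - P z := by
    intro z hz
    have hz0 : z ≠ 0 := by rintro rfl; simp at hz
    have h1 : Tendsto G (𝓝[≠] z) (𝓝 (G z)) := (hGan z hz.le).continuousAt.continuousWithinAt
    have h2 : Tendsto (fun w => laplaceTransform h w - P w) (𝓝[≠] z)
        (𝓝 (laplaceTransform h z - P z)) :=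
      ((continuousAt_laplaceTransform hconv hz).sub (hPan z hz0).continuousAt).continuousWithinAt
    refine tendsto_nhds_unique (h1.congr' ?_) h2
    have h3 := hmero.toMeromorphicNFOn_eq_self_on_nhdsNE (hHU hz.le)
    have h4 : ∀ᶠ w : ℂ in 𝓝[≠] z, 0 < w.re :=
      (Complex.continuous_re.continuousAt.eventually_const_lt hz).filter_mono nhdsWithin_le_nhds
    filter_upwards [h3, h4] with w hw hw0
    rw [hG, hw, hFeq w hw0]
  have hterm : ∀ j, ∀ z : ℂ, 0 < z.re → IntegrableOn (fun T : ℝ =>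
      a j / j.factorial * ((T : ℂ) ^ j * Complex.exp (-z * (T : ℂ)))) (Ioi 0) :=
    fun j z hz => (integrableOn_pow_mul_exp_neg_mul_ofReal j hz).const_mul _
  have hsplit : ∀ z : ℂ, ∀ T : ℝ, ((h T : ℂ) - ∑ j ∈ Finset.range (k + 1),
      a j / j.factorial * (T : ℂ) ^ j) * Complex.exp (-z * (T : ℂ)) =
      (h T : ℂ) * Complex.exp (-z * (T : ℂ)) - ∑ j ∈ Finset.range (k + 1),
        a j / j.factorial * ((T : ℂ) ^ j * Complex.exp (-z * (T : ℂ))) := by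
    intro z T
    rw [sub_mul, Finset.sum_mul]
    simp only [mul_assoc]
  refine ⟨fun j => a j / j.factorial, G, ⟨?_, ?_, ?_⟩, ?_⟩
  · intro z hz
    simp only [hsplit]
    exact (hconv z hz).sub (integrable_finsetSum _ fun j _ => hterm j z hz)
  · intro z hz
    simp only [hsplit]
    rw [integral_sub (hconv z hz) (integrable_finsetSum _ fun j _ => hterm j z hz),
      integral_finsetSum _ fun j _ => hterm j z hz, hGeq z hz]
    simp only [integral_const_mul, integral_pow_mul_exp_neg_mul_ofReal _ hz]
    congr 1
    refine Finset.sum_congr rfl fun j _ => ?_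
    have : (j.factorial : ℂ) ≠ 0 := by exact_mod_cast j.factorial_ne_zero
    field_simp
  · exact fun z hz => (hGan z hz).continuousAt.continuousWithinAt
  · have : (k.factorial : ℂ) ≠ 0 := by exact_mod_cast k.factorial_ne_zero
    simpa [div_mul_cancel₀ _ this] using ha

/-! ### Kernel averages as Fourier transforms of boundary values -/

namespace HasLaplaceBoundary

variable {h : ℝ → ℂ} {G : ℂ → ℂ} {φ : ℝ → ℂ} {K : ℝ → ℝ}

theorem integrableOn_exp (H : HasLaplaceBoundary h G) {ε : ℝ} (hε : 0 < ε) :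
    IntegrableOn (fun T : ℝ => h T * (Real.exp (-ε * T) : ℂ)) (Ioi 0) := by
  have := H.integrableOn (ε : ℂ) (by simpa using hε)
  refine this.congr (Eventually.of_forall fun T => ?_)
  simp

theorem integrableOn_exp_mul_kernel (H : HasLaplaceBoundary h G) (hK : IsBandLimitedKernel φ K)
    {ε : ℝ} (hε : 0 < ε) (x : ℝ) :
    IntegrableOn (fun T : ℝ => h T * (Real.exp (-ε * T) : ℂ) * (K (T - x) : ℂ)) (Ioi 0) := by
  refine (H.integrableOn_exp hε).mul_bdd (c := ∫ t, ‖φ t‖) ?_ (Eventually.of_forall fun T => ?_)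
  · exact (Complex.continuous_ofReal.comp
      (hK.kernel_continuous.comp (by fun_prop))).aestronglyMeasurable
  · rw [Complex.norm_real, Real.norm_of_nonneg (hK.nonneg _)]
    exact hK.kernel_le _

/-- Write `K` as the Fourier integral of `φ` and exchange integrals; the damping makes the double
integral absolutely convergent, and the inner integral over `T` is `G` on the line `Re z = ε`. -/
theorem integral_exp_mul_kernel (H : HasLaplaceBoundary h G) (hK : IsBandLimitedKernel φ K)
    {ε : ℝ} (hε : 0 < ε) (x : ℝ) :
    ∫ T in Ioi (0 : ℝ), h T * (Real.exp (-ε * T) : ℂ) * (K (T - x) : ℂ) =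
      𝓕 (fun t : ℝ => φ t * G (ε + (2 * Real.pi * t : ℝ) * Complex.I)) (-x) := by
  have hprod : Integrable (Function.uncurry fun T t : ℝ => h T * (Real.exp (-ε * T) : ℂ) *
      (φ t * Complex.exp (-(2 * Real.pi * t * (T - x) : ℝ) * Complex.I)))
      ((volume.restrict (Ioi 0)).prod volume) := by
    have h0 := (H.integrableOn_exp hε).mul_prod hK.integrable_symbol
    have h1 := h0.mul_bdd (c := 1)
      (g := fun p : ℝ × ℝ => Complex.exp (-(2 * Real.pi * p.2 * (p.1 - x) : ℝ) * Complex.I))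
      (Continuous.aestronglyMeasurable (by fun_prop)) (Eventually.of_forall fun p => by
        rw [← Complex.ofReal_neg, Complex.norm_exp_ofReal_mul_I])
    refine h1.congr (Eventually.of_forall fun p => ?_)
    simp only [Function.uncurry]
    ring
  have hswap := integral_integral_swap hprod
  simp only [integral_const_mul, hK.integral_symbol_mul_exp] at hswap
  rw [hswap, Real.fourier_real_eq_integral_exp_smul]
  congr 1
  ext t
  have hz : 0 < ((ε : ℂ) + (2 * Real.pi * t : ℝ) * Complex.I).re := by simpa using hε
  rw [← H.integral_eq _ hz, smul_eq_mul, ← integral_const_mul, ← integral_const_mul]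
  congr 1
  ext T
  have e1 : Complex.exp (-((ε : ℂ) + (2 * Real.pi * t : ℝ) * Complex.I) * T) =
      (Real.exp (-ε * T) : ℂ) * Complex.exp (-(2 * Real.pi * t * T : ℝ) * Complex.I) := by
    rw [Complex.ofReal_exp, ← Complex.exp_add]
    congr 1
    push_cast
    ring
  have e2 : Complex.exp (-(2 * Real.pi * t * (T - x) : ℝ) * Complex.I) =
      Complex.exp ((-2 * Real.pi * t * (-x) : ℝ) * Complex.I) *
        Complex.exp (-(2 * Real.pi * t * T : ℝ) * Complex.I) := by
    rw [← Complex.exp_add]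
    congr 1
    push_cast
    ring
  rw [e1, e2]
  ring

theorem continuous_comp_line (H : HasLaplaceBoundary h G) {ε : ℝ} (hε : 0 ≤ ε) :
    Continuous fun t : ℝ => G (ε + (2 * Real.pi * t : ℝ) * Complex.I) :=
  H.continuousOn.comp_continuous (by fun_prop) fun t => by simpa using hε

/-- Compact support of `φ` keeps the argument of `G` in a compact part of the closed half-plane,
where `G` is bounded; dominated convergence applies. -/
theorem tendsto_fourier (H : HasLaplaceBoundary h G) (hK : IsBandLimitedKernel φ K) (x : ℝ) :
    Tendsto (fun ε : ℝ => 𝓕 (fun t : ℝ => φ t * G (ε + (2 * Real.pi * t : ℝ) * Complex.I)) (-x))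
      (𝓝[>] 0) (𝓝 (𝓕 (fun t : ℝ => φ t * G ((2 * Real.pi * t : ℝ) * Complex.I)) (-x))) := by
  simp only [Real.fourier_real_eq_integral_exp_smul]
  have hcomp : IsCompact ((Icc (0 : ℝ) 1) ×ˢ tsupport φ) := isCompact_Icc.prod hK.compactSupport
  have hcont : ContinuousOn (fun p : ℝ × ℝ => G (p.1 + (2 * Real.pi * p.2 : ℝ) * Complex.I))
      ((Icc (0 : ℝ) 1) ×ˢ tsupport φ) := by
    refine H.continuousOn.comp (by fun_prop) fun p hp => ?_
    simpa using hp.1.1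
  obtain ⟨B, hB⟩ := hcomp.exists_bound_of_continuousOn hcont
  refine tendsto_integral_filter_of_dominated_convergence (fun t => ‖φ t‖ * B) ?_ ?_ ?_ ?_
  · filter_upwards [self_mem_nhdsWithin] with ε hε
    have h1 := H.continuous_comp_line (le_of_lt hε)
    have h2 := hK.continuous
    have h3 : Continuous fun t : ℝ =>
        Complex.exp ((-2 * Real.pi * t * (-x) : ℝ) * Complex.I) := by fun_prop
    exact (h3.smul (h2.mul h1)).aestronglyMeasurable
  · filter_upwards [Ioo_mem_nhdsGT (zero_lt_one (α := ℝ))] with ε hε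
    refine Eventually.of_forall fun t => ?_
    rw [norm_smul, Complex.norm_exp_ofReal_mul_I, one_mul, norm_mul]
    by_cases ht : t ∈ tsupport φ
    · exact mul_le_mul_of_nonneg_left (hB (ε, t) ⟨⟨hε.1.le, hε.2.le⟩, ht⟩) (norm_nonneg _)
    · simp [image_eq_zero_of_notMem_tsupport ht]
  · exact hK.integrable_symbol.norm.mul_const B
  · refine Eventually.of_forall fun t => Tendsto.const_smul (Tendsto.const_mul _ ?_) _
    have h1 : ContinuousOn (fun ε : ℝ => G (ε + (2 * Real.pi * t : ℝ) * Complex.I)) (Ici 0) :=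
      H.continuousOn.comp (by fun_prop) fun ε hε => by simpa using hε
    have h2 := (h1 0 self_mem_Ici).mono_left (nhdsWithin_mono _ Ioi_subset_Ici_self)
    simpa using h2

/-- Riemann–Lebesgue. No integrability is needed, since the integral of a nonintegrable function is
`0` by convention. -/
theorem tendsto_fourier_atTop (φ : ℝ → ℂ) (G : ℂ → ℂ) :
    Tendsto (fun x : ℝ => 𝓕 (fun t : ℝ => φ t * G ((2 * Real.pi * t : ℝ) * Complex.I)) (-x))
      atTop (𝓝 0) :=
  (Real.zero_at_infty_fourier _).comp (tendsto_neg_atTop_atBot.mono_right atBot_le_cocompact)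

theorem exists_norm_fourier_le (φ : ℝ → ℂ) (G : ℂ → ℂ) :
    ∃ B, ∀ x : ℝ, ‖𝓕 (fun t : ℝ => φ t * G ((2 * Real.pi * t : ℝ) * Complex.I)) (-x)‖ ≤ B :=
  ⟨_, fun x => VectorFourier.norm_fourierIntegral_le_integral_norm Real.fourierChar volume
    (innerₗ ℝ) _ (-x)⟩

end HasLaplaceBoundary

/-! ### Polynomial weights and kernel moments -/

theorem norm_sum_mul_pow_le (c : ℕ → ℂ) (k : ℕ) {T : ℝ} (hT : 0 ≤ T) :
    ‖∑ j ∈ Finset.range (k + 1), c j * (T : ℂ) ^ j‖ ≤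
      (∑ j ∈ Finset.range (k + 1), ‖c j‖) * (1 + T) ^ k := by
  rw [Finset.sum_mul]
  refine norm_sum_le_of_le _ fun j hj => ?_
  rw [norm_mul, norm_pow, Complex.norm_real, Real.norm_of_nonneg hT]
  gcongr
  calc T ^ j ≤ (1 + T) ^ j := by gcongr; linarith
    _ ≤ (1 + T) ^ k := pow_le_pow_right₀ (by linarith) (Nat.lt_succ_iff.1 (Finset.mem_range.1 hj))

/-- Moves a polynomial weight from `T` to the centre `x`, at the price of a kernel moment. -/
theorem one_add_le_one_add_mul_one_add_abs_sub {T x : ℝ} (hx : 0 ≤ x) :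
    1 + T ≤ (1 + x) * (1 + |T - x|) := by
  nlinarith [le_abs_self (T - x), mul_nonneg hx (abs_nonneg (T - x))]

namespace IsBandLimitedKernel

variable {φ : ℝ → ℂ} {K : ℝ → ℝ}

theorem integrable_moment_sub (hK : IsBandLimitedKernel φ K) (n : ℕ) (x : ℝ) :
    Integrable fun T => (1 + |T - x|) ^ n * K (T - x) :=
  (hK.moments n).comp_sub_right x

theorem integrableOn_pow_mul_sub (hK : IsBandLimitedKernel φ K) (n : ℕ) {x : ℝ} (hx : 0 ≤ x) :
    IntegrableOn (fun T => (1 + T) ^ n * K (T - x)) (Ioi 0) := by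
  refine (((hK.integrable_moment_sub n x).const_mul ((1 + x) ^ n)).integrableOn (s := Ioi 0)).mono'
    ((Continuous.mul (by fun_prop)
      (hK.kernel_continuous.comp (by fun_prop))).aestronglyMeasurable) ?_
  filter_upwards [ae_restrict_mem measurableSet_Ioi] with T hT
  have hT' : 0 < T := hT
  have h0 := hK.nonneg (T - x)
  rw [Real.norm_of_nonneg (by positivity), ← mul_assoc, ← mul_pow]
  gcongr
  exact one_add_le_one_add_mul_one_add_abs_sub hx

theorem integral_moment_scale_le (hK : IsBandLimitedKernel φ K) (n : ℕ) {s : ℝ} (hs : 1 ≤ s) :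
    ∫ u, (1 + |u|) ^ n * K (s * u) ≤ s⁻¹ * ∫ u, (1 + |u|) ^ n * K u := by
  have hs0 : 0 < s := by linarith
  have h1 := Measure.integral_comp_mul_left (fun v => (1 + |v|) ^ n * K v) s
  rw [abs_of_pos (inv_pos.2 hs0), smul_eq_mul] at h1
  rw [← h1]
  refine integral_mono ((hK.scale hs0).moments n) ((hK.moments n).comp_mul_left' hs0.ne')
    fun u => ?_
  have h0 := hK.nonneg (s * u)
  have : |u| ≤ |s * u| := by
    rw [abs_mul, abs_of_pos hs0]
    nlinarith [abs_nonneg u]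
  dsimp only
  gcongr

/-- The factor `s⁻¹` becomes the window length `δ` and makes the polynomial's contribution to a
window proportional to that length. -/
theorem setIntegral_pow_mul_scale_sub_le (hK : IsBandLimitedKernel φ K) (n : ℕ) {s x : ℝ}
    (hs : 1 ≤ s) (hx : 0 ≤ x) :
    ∫ T in Ioi (0 : ℝ), (1 + T) ^ n * K (s * (T - x)) ≤
      s⁻¹ * (∫ u, (1 + |u|) ^ n * K u) * (1 + x) ^ n := by
  have hs0 : 0 < s := by linarith
  have hK' := hK.scale hs0
  calc ∫ T in Ioi (0 : ℝ), (1 + T) ^ n * K (s * (T - x))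
      ≤ ∫ T in Ioi (0 : ℝ), (1 + x) ^ n * ((1 + |T - x|) ^ n * K (s * (T - x))) := by
        refine setIntegral_mono_on (hK'.integrableOn_pow_mul_sub n hx)
          (((hK'.integrable_moment_sub n x).const_mul _).integrableOn) measurableSet_Ioi
          fun T hT => ?_
        have hT' : 0 < T := hT
        have h0 := hK.nonneg (s * (T - x))
        rw [← mul_assoc, ← mul_pow]
        gcongr
        exact one_add_le_one_add_mul_one_add_abs_sub hx
    _ ≤ ∫ T, (1 + x) ^ n * ((1 + |T - x|) ^ n * K (s * (T - x))) := by
        refine setIntegral_le_integral ((hK'.integrable_moment_sub n x).const_mul _)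
          (Eventually.of_forall fun T => ?_)
        have h0 := hK.nonneg (s * (T - x))
        simp only [Pi.zero_apply]
        positivity
    _ = (1 + x) ^ n * ∫ u, (1 + |u|) ^ n * K (s * u) := by
        rw [integral_const_mul, integral_sub_right_eq_self fun u => (1 + |u|) ^ n * K (s * u)]
    _ ≤ (1 + x) ^ n * (s⁻¹ * ∫ u, (1 + |u|) ^ n * K u) := by
        gcongr
        exact hK.integral_moment_scale_le n hs
    _ = _ := by ring

end IsBandLimitedKernel

/-! ### Window bounds for nonnegative functions -/

theorem integrableOn_Icc_of_laplaceConvergesAt {a : ℝ → ℝ}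
    (ha : ∀ z : ℂ, 0 < z.re → LaplaceConvergesAt a z) (b : ℝ) : IntegrableOn a (Icc 0 b) := by
  have h1 : IntegrableOn (fun T : ℝ => a T * Real.exp (-T)) (Ioi 0) := by
    refine (ha 1 (by simp)).re.congr (Eventually.of_forall fun T => ?_)
    simp only [RCLike.re_eq_complex_re]
    rw [neg_one_mul, ← Complex.ofReal_neg, ← Complex.ofReal_exp, ← Complex.ofReal_mul,
      Complex.ofReal_re]
  have h2 : IntegrableOn (fun T : ℝ => a T * Real.exp (-T)) (Icc 0 b) := by
    rw [integrableOn_Icc_iff_integrableOn_Ioc]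
    exact h1.mono_set Ioc_subset_Ioi_self
  have h3 := h2.mul_continuousOn (g' := fun T => Real.exp T) (by fun_prop) isCompact_Icc
  refine h3.congr (Eventually.of_forall fun T => ?_)
  simp only [mul_assoc, ← Real.exp_add]
  simp

/-- Since `a ≥ 0` and `K ≥ c₀` on the window, the window integral is controlled by the damped kernel
average of `a`. That average splits into the one of `a - Q`, a Fourier transform, and a polynomial
part bounded uniformly in `ε`; then `ε → 0`. -/
theorem HasLaplaceBoundary.setIntegral_Ioc_le {a : ℝ → ℝ} {c : ℕ → ℂ} {k : ℕ} {G : ℂ → ℂ}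
    {φ : ℝ → ℂ} {K : ℝ → ℝ}
    (H : HasLaplaceBoundary (fun T => (a T : ℂ) - ∑ j ∈ Finset.range (k + 1), c j * (T : ℂ) ^ j) G)
    (ha : ∀ T, 0 ≤ T → 0 ≤ a T) (hint : ∀ b, IntegrableOn a (Icc 0 b))
    (hK : IsBandLimitedKernel φ K) {c₀ δ : ℝ} (hc₀ : 0 ≤ c₀) (hcK : ∀ u ∈ Icc 0 δ, c₀ ≤ K u)
    {x : ℝ} (hx : 0 ≤ x) :
    c₀ * ∫ T in Ioc x (x + δ), a T ≤
      ‖𝓕 (fun t : ℝ => φ t * G ((2 * Real.pi * t : ℝ) * Complex.I)) (-x)‖ +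
        (∑ j ∈ Finset.range (k + 1), ‖c j‖) * ∫ T in Ioi (0 : ℝ), (1 + T) ^ k * K (T - x) := by
  set q := ∑ j ∈ Finset.range (k + 1), ‖c j‖
  set Q : ℝ → ℂ := fun T => ∑ j ∈ Finset.range (k + 1), c j * (T : ℂ) ^ j with hQ
  have hsub : Ioc x (x + δ) ⊆ Ioi 0 := fun T hT => hx.trans_lt hT.1
  have hI : IntegrableOn a (Ioc x (x + δ)) :=
    (hint (x + δ)).mono_set fun T hT => ⟨(hx.trans_lt hT.1).le, hT.2⟩
  have hkey : ∀ ε > 0, Real.exp (-ε * (x + δ)) * (c₀ * ∫ T in Ioc x (x + δ), a T) ≤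
      ‖𝓕 (fun t : ℝ => φ t * G (ε + (2 * Real.pi * t : ℝ) * Complex.I)) (-x)‖ +
        q * ∫ T in Ioi (0 : ℝ), (1 + T) ^ k * K (T - x) := by
    intro ε hε
    have hi1 := H.integrableOn_exp_mul_kernel hK hε x
    have hi2 := (hK.integrableOn_pow_mul_sub k hx).const_mul q
    -- An integrable majorant of the damped `a * K`: the polynomial is replaced by its undamped
    -- bound, so that the second term does not depend on `ε`.
    set S : ℝ → ℝ := fun T =>
      (((a T : ℂ) - Q T) * (Real.exp (-ε * T) : ℂ) * (K (T - x) : ℂ)).re +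
        q * ((1 + T) ^ k * K (T - x)) with hS
    have hiS : IntegrableOn S (Ioi 0) := hi1.re.add hi2
    have hle : ∀ T, 0 < T → Real.exp (-ε * T) * K (T - x) * a T ≤ S T := by
      intro T hT
      have h1 : (Q T).re ≤ q * (1 + T) ^ k :=
        (Complex.re_le_norm _).trans (norm_sum_mul_pow_le c k hT.le)
      have h2 : (((a T : ℂ) - Q T) * (Real.exp (-ε * T) : ℂ) * (K (T - x) : ℂ)).re =
          (a T - (Q T).re) * Real.exp (-ε * T) * K (T - x) := by
        rw [Complex.re_mul_ofReal, Complex.re_mul_ofReal, Complex.sub_re, Complex.ofReal_re]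
      have h3 : Real.exp (-ε * T) ≤ 1 := by
        rw [Real.exp_le_one_iff]; nlinarith
      have h4 := hK.nonneg (T - x)
      have h5 : 0 ≤ q * (1 + T) ^ k := by positivity
      have h6 : (Q T).re * Real.exp (-ε * T) ≤ q * (1 + T) ^ k :=
        (mul_le_mul_of_nonneg_right h1 (Real.exp_pos _).le).trans (mul_le_of_le_one_right h5 h3)
      rw [hS]
      simp only [h2]
      nlinarith [mul_le_mul_of_nonneg_right h6 h4]
    have hS0 : ∀ T, 0 < T → 0 ≤ S T := fun T hT =>
      (mul_nonneg (mul_nonneg (Real.exp_pos _).le (hK.nonneg _)) (ha T hT.le)).trans (hle T hT)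
    calc Real.exp (-ε * (x + δ)) * (c₀ * ∫ T in Ioc x (x + δ), a T)
        = ∫ T in Ioc x (x + δ), Real.exp (-ε * (x + δ)) * (c₀ * a T) := by
          rw [integral_const_mul, integral_const_mul]
      _ ≤ ∫ T in Ioc x (x + δ), S T := by
          refine setIntegral_mono_on ((hI.const_mul _).const_mul _) (hiS.mono_set hsub)
            measurableSet_Ioc fun T hT => ?_
          have hT0 : 0 < T := hsub hT
          refine le_trans ?_ (hle T hT0)
          have h1 := ha T hT0.le
          have h2 := hcK (T - x) ⟨by linarith [hT.1], by linarith [hT.2]⟩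
          rw [← mul_assoc]
          have h3 : Real.exp (-ε * (x + δ)) ≤ Real.exp (-ε * T) :=
            Real.exp_le_exp.2 (by nlinarith [hT.2])
          gcongr
      _ ≤ ∫ T in Ioi 0, S T := by
          refine setIntegral_mono_set hiS ?_ hsub.eventuallyLE
          filter_upwards [ae_restrict_mem measurableSet_Ioi] with T hT using hS0 T hT
      _ = (∫ T in Ioi (0 : ℝ),
            ((a T : ℂ) - Q T) * (Real.exp (-ε * T) : ℂ) * (K (T - x) : ℂ)).re +
            q * ∫ T in Ioi (0 : ℝ), (1 + T) ^ k * K (T - x) := by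
          rw [← integral_const_mul]
          refine (integral_add hi1.re hi2).trans ?_
          congr 1
          exact integral_re hi1
      _ ≤ _ := by
          rw [← H.integral_exp_mul_kernel hK hε x]
          gcongr
          exact Complex.re_le_norm _
  have hlim1 : Tendsto (fun ε : ℝ => Real.exp (-ε * (x + δ)) * (c₀ * ∫ T in Ioc x (x + δ), a T))
      (𝓝[>] 0) (𝓝 (c₀ * ∫ T in Ioc x (x + δ), a T)) := by
    have : ContinuousAt (fun ε : ℝ => Real.exp (-ε * (x + δ)) *
      (c₀ * ∫ T in Ioc x (x + δ), a T)) 0 := by fun_prop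
    have h2 := this.tendsto.mono_left (nhdsWithin_le_nhds (s := Ioi 0))
    simpa using h2
  refine le_of_tendsto_of_tendsto hlim1 (((H.tendsto_fourier hK x).norm).add_const _) ?_
  filter_upwards [self_mem_nhdsWithin] with ε hε using hkey ε hε

/-- A function has windows bounded in degree `k` if its integral over windows of length `δ ≤ 1`
far enough to the right is bounded by a multiple of `δ * (1 + x) ^ k`. -/
def HasBoundedWindows (a : ℝ → ℝ) (k : ℕ) (N : ℝ) : Prop :=
  (∀ x, 0 ≤ x → ∫ T in x..x + 1, a T ≤ N * (1 + x) ^ k) ∧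
    ∀ δ, 0 < δ → δ ≤ 1 → ∃ X, 0 ≤ X ∧ ∀ x, X ≤ x → ∫ T in x..x + δ, a T ≤ N * δ * (1 + x) ^ k

theorem HasLaplaceBoundary.exists_hasBoundedWindows {a : ℝ → ℝ} {c : ℕ → ℂ} {k : ℕ} {G : ℂ → ℂ}
    (H : HasLaplaceBoundary (fun T => (a T : ℂ) - ∑ j ∈ Finset.range (k + 1), c j * (T : ℂ) ^ j) G)
    (ha : ∀ T, 0 ≤ T → 0 ≤ a T) (hint : ∀ b, IntegrableOn a (Icc 0 b)) :
    ∃ N, 0 ≤ N ∧ HasBoundedWindows a k N := by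
  obtain ⟨φ, K, hK, c₀, hc₀, hcK⟩ := exists_isBandLimitedKernel
  set q := ∑ j ∈ Finset.range (k + 1), ‖c j‖ with hq
  have hq0 : 0 ≤ q := by positivity
  set κ := ∫ u, (1 + |u|) ^ k * K u with hκ
  have hκ0 : 0 ≤ κ := integral_nonneg fun u => mul_nonneg (by positivity) (hK.nonneg u)
  have hscaled : ∀ δ, 0 < δ → δ ≤ 1 → ∃ φ' : ℝ → ℂ, ∀ x, 0 ≤ x → c₀ * ∫ T in x..x + δ, a T ≤
      ‖𝓕 (fun t : ℝ => φ' t * G ((2 * Real.pi * t : ℝ) * Complex.I)) (-x)‖ +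
        q * κ * δ * (1 + x) ^ k := by
    intro δ hδ hδ1
    have hs : 1 ≤ δ⁻¹ := (one_le_inv₀ hδ).2 hδ1
    refine ⟨fun t => ((δ⁻¹ : ℝ) : ℂ)⁻¹ * φ (δ⁻¹⁻¹ * t), fun x hx => ?_⟩
    have h1 := H.setIntegral_Ioc_le ha hint (hK.scale (inv_pos.2 hδ)) hc₀.le (δ := δ)
      (fun u hu => hcK _ ⟨mul_nonneg (inv_pos.2 hδ).le hu.1, by
        rw [inv_mul_le_iff₀ hδ, mul_one]; exact hu.2⟩) hx
    rw [intervalIntegral.integral_of_le (by linarith)]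
    refine h1.trans ?_
    have h2 := hK.setIntegral_pow_mul_scale_sub_le k hs hx
    rw [inv_inv] at h2
    have h3 := mul_le_mul_of_nonneg_left h2 hq0
    linarith
  obtain ⟨φ₁, hφ₁⟩ := hscaled 1 one_pos le_rfl
  obtain ⟨B, hB⟩ := HasLaplaceBoundary.exists_norm_fourier_le φ₁ G
  have hB0 : 0 ≤ B := (norm_nonneg _).trans (hB 0)
  -- `B` pays for the Fourier term on unit windows starting anywhere; `1` pays for it on short
  -- windows, where Riemann–Lebesgue makes it less than `δ` far out. Only the threshold `X` depends
  -- on `δ`.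
  refine ⟨(B + q * κ + 1) / c₀, by positivity, fun x hx => ?_, fun δ hδ hδ1 => ?_⟩
  · have h1 := hφ₁ x hx
    have h2 := hB x
    have h3 : 1 ≤ (1 + x) ^ k := one_le_pow₀ (by linarith)
    rw [div_mul_eq_mul_div, le_div_iff₀ hc₀]
    nlinarith
  · obtain ⟨φ', hφ'⟩ := hscaled δ hδ hδ1
    have h1 := (HasLaplaceBoundary.tendsto_fourier_atTop φ' G).norm
    rw [norm_zero] at h1
    obtain ⟨X, hX⟩ := eventually_atTop.1 (h1.eventually_lt_const hδ)
    refine ⟨max X 0, le_max_right _ _, fun x hx => ?_⟩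
    have hx0 : 0 ≤ x := (le_max_right _ _).trans hx
    have h2 := hφ' x hx0
    have h3 := hX x ((le_max_left _ _).trans hx)
    have h4 : 1 ≤ (1 + x) ^ k := one_le_pow₀ (by linarith)
    rw [div_mul_eq_mul_div, div_mul_eq_mul_div, le_div_iff₀ hc₀]
    have h5 : 0 ≤ B * δ * (1 + x) ^ k := by positivity
    nlinarith [mul_le_mul_of_nonneg_left h4 hδ.le]

/-! ### From window bounds to slow oscillation -/

theorem intervalIntegrable_of_integrableOn_Icc {a : ℝ → ℝ} (hint : ∀ b, IntegrableOn a (Icc 0 b))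
    {x y : ℝ} (hx : 0 ≤ x) (hxy : x ≤ y) : IntervalIntegrable a volume x y := by
  rw [intervalIntegrable_iff_integrableOn_Ioc_of_le hxy]
  exact (hint y).mono_set fun T hT => ⟨hx.trans hT.1.le, hT.2⟩

/-- Cover the interval by consecutive windows: the last one overshoots by at most `δ`, and every
window starts before `y`, so its weight is at most `(1 + y) ^ k`. -/
theorem intervalIntegral_le_of_windows {a : ℝ → ℝ} {k : ℕ} {N X δ : ℝ} (hX : 0 ≤ X) (hδ : 0 < δ)
    (hN : 0 ≤ N) (ha : ∀ T, 0 ≤ T → 0 ≤ a T) (hint : ∀ b, IntegrableOn a (Icc 0 b))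
    (hw : ∀ x, X ≤ x → ∫ T in x..x + δ, a T ≤ N * δ * (1 + x) ^ k) {x y : ℝ} (hx : X ≤ x)
    (hxy : x ≤ y) : ∫ T in x..y, a T ≤ N * (y - x + δ) * (1 + y) ^ k := by
  have hx0 : 0 ≤ x := hX.trans hx
  set n := ⌈(y - x) / δ⌉₊ with hn
  have hn1 : y - x ≤ n * δ := (div_le_iff₀ hδ).1 (Nat.le_ceil _)
  have hn2 : n * δ ≤ y - x + δ := by
    have := (Nat.ceil_lt_add_one (div_nonneg (sub_nonneg.2 hxy) hδ.le)).le
    calc n * δ ≤ ((y - x) / δ + 1) * δ := by gcongr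
      _ = y - x + δ := by field_simp
  have hpt : ∀ i : ℕ, 0 ≤ x + i * δ := fun i => by positivity
  calc ∫ T in x..y, a T ≤ ∫ T in x..x + n * δ, a T := by
        refine intervalIntegral.integral_mono_interval le_rfl hxy (by linarith) ?_
          (intervalIntegrable_of_integrableOn_Icc hint hx0 (by linarith))
        filter_upwards [ae_restrict_mem measurableSet_Ioc] with T hT
        exact ha T (hx0.trans hT.1.le)
    _ = ∑ i ∈ Finset.range n, ∫ T in x + (i : ℕ) * δ..x + (i + 1 : ℕ) * δ, a T := by
        have := intervalIntegral.sum_integral_adjacent_intervals (f := a) (μ := volume) (n := n)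
          (a := fun i : ℕ => x + i * δ) fun i _ =>
            intervalIntegrable_of_integrableOn_Icc hint (hpt i) (by push_cast; linarith)
        simpa using this.symm
    _ ≤ ∑ i ∈ Finset.range n, N * δ * (1 + y) ^ k := by
        refine Finset.sum_le_sum fun i hi => ?_
        have h1 : x + (i + 1 : ℕ) * δ = x + i * δ + δ := by push_cast; ring
        have h2 : i * δ < y - x := (lt_div_iff₀ hδ).1 (Nat.lt_ceil.1 (Finset.mem_range.1 hi))
        rw [h1]
        have h3 : 0 ≤ i * δ := by positivity
        refine (hw _ (by linarith)).trans ?_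
        have := hpt i
        gcongr
        linarith
    _ = N * (n * δ) * (1 + y) ^ k := by
        rw [Finset.sum_const, Finset.card_range, nsmul_eq_mul]; ring
    _ ≤ N * (y - x + δ) * (1 + y) ^ k := by
        have : 0 ≤ y := hx0.trans hxy
        gcongr

theorem HasBoundedWindows.exists_oscillation_le {f a : ℝ → ℝ} {k : ℕ} {N : ℝ}
    (hw : HasBoundedWindows a k N) (hN : 0 ≤ N) (ha : ∀ T, 0 ≤ T → 0 ≤ a T)
    (hint : ∀ b, IntegrableOn a (Icc 0 b))
    (hfa : ∀ x y, 0 ≤ x → x ≤ y → |f y - f x| ≤ ∫ T in x..y, a T) {δ : ℝ} (hδ : 0 < δ)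
    (hδ1 : δ ≤ 1) : ∃ X, 0 ≤ X ∧ ∀ x, X ≤ x → ∀ T, 0 ≤ T →
      |f T - f x| ≤ 2 * N * (|T - x| + δ) * ((1 + x) * (1 + |T - x|)) ^ k := by
  obtain ⟨X, hX0, hX⟩ := hw.2 δ hδ hδ1
  -- The extra `1` keeps both endpoints beyond `X` when `|T - x| ≤ 1`.
  refine ⟨X + 1, by linarith, fun x hx T hT => ?_⟩
  have hx0 : 0 ≤ x := by linarith
  have hu := abs_nonneg (T - x)
  have habs : |f T - f x| ≤ ∫ t in min x T..max x T, a t := by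
    rcases le_total x T with h | h
    · rw [min_eq_left h, max_eq_right h]; exact hfa x T hx0 h
    · rw [min_eq_right h, max_eq_left h, abs_sub_comm]; exact hfa T x hT h
  have hlo : 0 ≤ min x T := le_min hx0 hT
  have hsub : max x T - min x T = |T - x| := max_sub_min_eq_abs x T
  have hhi0 : 0 ≤ max x T := hx0.trans (le_max_left _ _)
  have hhi : 1 + max x T ≤ (1 + x) * (1 + |T - x|) := by
    rcases le_total x T with h | h
    · rw [max_eq_right h]; exact one_add_le_one_add_mul_one_add_abs_sub hx0
    · rw [max_eq_left h]; nlinarith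
  refine habs.trans ?_
  rcases le_total |T - x| 1 with h | h
  · have hXlo : X ≤ min x T := by
      refine le_min (by linarith) ?_
      have := abs_le.1 h
      linarith [this.1]
    have h1 := intervalIntegral_le_of_windows hX0 hδ hN ha hint hX hXlo min_le_max
    rw [hsub] at h1
    refine h1.trans ?_
    gcongr
    linarith
  -- Far from `x`, `T` may lie below `X`, so unit windows starting from `0` are used; the error `1`
  -- in place of `δ` is absorbed by the factor `2`.
  · have h1 := intervalIntegral_le_of_windows le_rfl one_pos hN ha hint
      (fun x hx => by simpa using hw.1 x hx) hlo min_le_max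
    rw [hsub] at h1
    refine h1.trans ?_
    have h2 : N * (|T - x| + 1) ≤ 2 * N * (|T - x| + δ) := by nlinarith
    gcongr

theorem norm_sum_mul_pow_sub_le (c : ℕ → ℂ) (k : ℕ) {T x : ℝ} (hT : 0 ≤ T) (hx : 0 ≤ x) :
    ‖(∑ j ∈ Finset.range (k + 1), c j * (T : ℂ) ^ j) -
        ∑ j ∈ Finset.range (k + 1), c j * (x : ℂ) ^ j‖ ≤
      (∑ j ∈ Finset.range (k + 1), ‖c j‖ * j) * |T - x| * ((1 + x) * (1 + |T - x|)) ^ k := by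
  rw [← Finset.sum_sub_distrib, Finset.sum_mul, Finset.sum_mul]
  refine norm_sum_le_of_le _ fun j hj => ?_
  have hu := abs_nonneg (T - x)
  have h1 := abs_pow_sub_pow_le T x j
  have hone : 1 ≤ (1 + x) * (1 + |T - x|) := by nlinarith
  have h2 : max |T| |x| ≤ (1 + x) * (1 + |T - x|) := by
    rw [abs_of_nonneg hT, abs_of_nonneg hx]
    refine max_le ?_ (by nlinarith)
    linarith [one_add_le_one_add_mul_one_add_abs_sub (T := T) hx]
  have h3 : max |T| |x| ^ (j - 1) ≤ ((1 + x) * (1 + |T - x|)) ^ k := by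
    have : j - 1 ≤ k := by have := Finset.mem_range.1 hj; omega
    calc max |T| |x| ^ (j - 1) ≤ ((1 + x) * (1 + |T - x|)) ^ (j - 1) := by gcongr
      _ ≤ _ := pow_le_pow_right₀ hone this
  have h4 : ‖(T : ℂ) ^ j - (x : ℂ) ^ j‖ = |T ^ j - x ^ j| := by
    rw [← Complex.ofReal_pow, ← Complex.ofReal_pow, ← Complex.ofReal_sub, Complex.norm_real,
      Real.norm_eq_abs]
  rw [← mul_sub, norm_mul, h4]
  calc ‖c j‖ * |T ^ j - x ^ j| ≤ ‖c j‖ * (|T - x| * j * max |T| |x| ^ (j - 1)) := by gcongr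
    _ ≤ ‖c j‖ * (|T - x| * j * ((1 + x) * (1 + |T - x|)) ^ k) := by gcongr
    _ = _ := by ring

/-! ### The Tauberian step -/

/-- Substituting `u = δ v` yields one `δ` from the width of the kernel and one from the displacement
`|u| + δ`. The second power is what beats the kernel mass, of order `δ`. -/
theorem IsBandLimitedKernel.integral_abs_add_mul_scale_le {φ : ℝ → ℂ} {K : ℝ → ℝ}
    (hK : IsBandLimitedKernel φ K) (k : ℕ) {δ : ℝ} (hδ : 0 < δ) (hδ1 : δ ≤ 1) :
    Integrable (fun u => (|u| + δ) * (1 + |u|) ^ k * K (δ⁻¹ * u)) ∧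
    ∫ u, (|u| + δ) * (1 + |u|) ^ k * K (δ⁻¹ * u) ≤ δ ^ 2 * ∫ u, (1 + |u|) ^ (k + 1) * K u := by
  have hδi : 0 < δ⁻¹ := inv_pos.2 hδ
  have hI : Integrable (fun u => (|u| + δ) * (1 + |u|) ^ k * K (δ⁻¹ * u)) := by
    refine ((hK.scale hδi).moments (k + 1)).mono' ((Continuous.mul (by fun_prop)
      (hK.kernel_continuous.comp (by fun_prop))).aestronglyMeasurable)
      (Eventually.of_forall fun u => ?_)
    have h0 := hK.nonneg (δ⁻¹ * u)
    have h1 : |u| + δ ≤ 1 + |u| := by linarith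
    rw [Real.norm_of_nonneg (by positivity), pow_succ']
    exact mul_le_mul_of_nonneg_right (mul_le_mul_of_nonneg_right h1 (by positivity)) h0
  refine ⟨hI, ?_⟩
  have h1 := Measure.integral_comp_mul_left
    (fun u => (|u| + δ) * (1 + |u|) ^ k * K (δ⁻¹ * u)) δ
  rw [abs_of_pos hδi, smul_eq_mul, inv_mul_eq_div, eq_div_iff hδ.ne'] at h1
  rw [← h1, mul_comm, sq, mul_assoc]
  refine mul_le_mul_of_nonneg_left ?_ hδ.le
  rw [← integral_const_mul]
  refine integral_mono (hI.comp_mul_left' hδ.ne') ((hK.moments (k + 1)).const_mul δ) fun u => ?_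
  have h0 := hK.nonneg u
  have h2 : |δ * u| = δ * |u| := by rw [abs_mul, abs_of_pos hδ]
  have h3 : δ⁻¹ * (δ * u) = u := by field_simp
  have h4 : δ * |u| ≤ |u| := mul_le_of_le_one_left (abs_nonneg u) hδ1
  dsimp only
  rw [h2, h3]
  calc (δ * |u| + δ) * (1 + δ * |u|) ^ k * K u ≤ (δ * |u| + δ) * (1 + |u|) ^ k * K u := by gcongr
    _ = δ * ((1 + |u|) ^ (k + 1) * K u) := by ring

namespace HasLaplaceBoundary

/-- Polynomial growth of `g` and the moments of `K` dominate the integrand uniformly in `ε`, so the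
damping can be removed. -/
theorem integral_mul_kernel {g : ℝ → ℂ} {G : ℂ → ℂ} (H : HasLaplaceBoundary g G) {B : ℝ} {n : ℕ}
    (hB : ∀ T, 0 ≤ T → ‖g T‖ ≤ B * (1 + T) ^ n) {φ : ℝ → ℂ} {K : ℝ → ℝ}
    (hK : IsBandLimitedKernel φ K) {x : ℝ} (hx : 0 ≤ x) :
    IntegrableOn (fun T => g T * (K (T - x) : ℂ)) (Ioi 0) ∧
    ∫ T in Ioi (0 : ℝ), g T * (K (T - x) : ℂ) =
      𝓕 (fun t : ℝ => φ t * G ((2 * Real.pi * t : ℝ) * Complex.I)) (-x) := by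
  have hgm : AEStronglyMeasurable g (volume.restrict (Ioi 0)) := by
    have h1 := (H.integrableOn_exp one_pos).aestronglyMeasurable.mul
      (g := fun T : ℝ => (Real.exp T : ℂ)) (by fun_prop)
    refine h1.congr (Eventually.of_forall fun T => ?_)
    simp only [Pi.mul_apply]
    rw [mul_assoc, ← Complex.ofReal_mul, ← Real.exp_add]
    simp
  have hKm : AEStronglyMeasurable (fun T : ℝ => (K (T - x) : ℂ)) (volume.restrict (Ioi 0)) :=
    (Complex.continuous_ofReal.comp (hK.kernel_continuous.comp (by fun_prop))).aestronglyMeasurable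
  have hbound : IntegrableOn (fun T => B * ((1 + T) ^ n * K (T - x))) (Ioi 0) :=
    (hK.integrableOn_pow_mul_sub n hx).const_mul B
  have hle : ∀ᵐ T ∂volume.restrict (Ioi (0 : ℝ)),
      ‖g T * (K (T - x) : ℂ)‖ ≤ B * ((1 + T) ^ n * K (T - x)) := by
    filter_upwards [ae_restrict_mem measurableSet_Ioi] with T hT
    have hT' : 0 < T := hT
    rw [norm_mul, Complex.norm_real, Real.norm_of_nonneg (hK.nonneg _), ← mul_assoc]
    exact mul_le_mul_of_nonneg_right (hB T hT'.le) (hK.nonneg _)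
  refine ⟨hbound.mono' (hgm.mul hKm) hle, ?_⟩
  have hlim : Tendsto (fun ε : ℝ => ∫ T in Ioi (0 : ℝ),
      g T * (Real.exp (-ε * T) : ℂ) * (K (T - x) : ℂ)) (𝓝[>] 0)
      (𝓝 (∫ T in Ioi (0 : ℝ), g T * (K (T - x) : ℂ))) := by
    refine tendsto_integral_filter_of_dominated_convergence _ ?_ ?_ hbound ?_
    · exact Eventually.of_forall fun ε => (hgm.mul (by fun_prop)).mul hKm
    · filter_upwards [self_mem_nhdsWithin] with ε hε
      have hε' : 0 < ε := hε
      filter_upwards [hle, ae_restrict_mem measurableSet_Ioi] with T hT hT0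
      have hT0' : 0 < T := hT0
      refine le_trans ?_ hT
      rw [mul_right_comm, norm_mul _ ((Real.exp (-ε * T) : ℝ) : ℂ)]
      refine mul_le_of_le_one_right (norm_nonneg _) ?_
      rw [Complex.norm_real, Real.norm_of_nonneg (Real.exp_pos _).le, Real.exp_le_one_iff]
      nlinarith
    · refine Eventually.of_forall fun T => ?_
      have h1 : ContinuousAt (fun ε : ℝ => g T * (Real.exp (-ε * T) : ℂ) * (K (T - x) : ℂ)) 0 := by
        fun_prop
      have h2 := h1.tendsto.mono_left (nhdsWithin_le_nhds (s := Ioi 0))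
      simpa using h2
  refine tendsto_nhds_unique (hlim.congr' ?_) (H.tendsto_fourier hK x)
  filter_upwards [self_mem_nhdsWithin] with ε hε using H.integral_exp_mul_kernel hK hε x

/-- A slowly oscillating function whose Laplace transform extends continuously to the imaginary
axis is negligible with respect to `x ^ k`. -/
theorem eventually_norm_le {g : ℝ → ℂ} {G : ℂ → ℂ} (H : HasLaplaceBoundary g G) {k : ℕ} {M : ℝ}
    (hM : 0 ≤ M)
    (hosc : ∀ δ, 0 < δ → δ ≤ 1 → ∃ X, 0 ≤ X ∧ ∀ x, X ≤ x → ∀ T, 0 ≤ T →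
      ‖g T - g x‖ ≤ M * (|T - x| + δ) * ((1 + x) * (1 + |T - x|)) ^ k) {η : ℝ} (hη : 0 < η) :
    ∀ᶠ x in atTop, ‖g x‖ ≤ η * (1 + x) ^ k := by
  obtain ⟨φ, K, hK, c₀, hc₀, hcK⟩ := exists_isBandLimitedKernel
  set κ := ∫ u, (1 + |u|) ^ (k + 1) * K u with hκ
  have hκ0 : 0 ≤ κ := integral_nonneg fun u => mul_nonneg (by positivity) (hK.nonneg u)
  -- Oscillation measured from one fixed base point already gives polynomial growth, of degree `k +
  -- 1` because of the factor `|T - X| + 1`.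
  obtain ⟨B, hB⟩ : ∃ B, ∀ T, 0 ≤ T → ‖g T‖ ≤ B * (1 + T) ^ (k + 1) := by
    obtain ⟨X, hX0, hX⟩ := hosc 1 one_pos le_rfl
    refine ⟨‖g X‖ + M * (1 + X) ^ k * (1 + X) ^ (k + 1), fun T hT => ?_⟩
    have h1 := hX X le_rfl T hT
    have h2 : ‖g T‖ ≤ ‖g X‖ + ‖g T - g X‖ := by
      have := norm_add_le (g X) (g T - g X)
      rwa [add_sub_cancel] at this
    have h3 : 1 + |T - X| ≤ (1 + X) * (1 + T) := by
      have : |T - X| ≤ T + X := abs_le.2 ⟨by linarith, by linarith⟩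
      nlinarith
    have h4 : 1 ≤ (1 + T) ^ (k + 1) := one_le_pow₀ (by linarith)
    calc ‖g T‖ ≤ ‖g X‖ * 1 + M * (|T - X| + 1) * ((1 + X) * (1 + |T - X|)) ^ k := by linarith
      _ = ‖g X‖ * 1 + M * (1 + X) ^ k * (1 + |T - X|) ^ (k + 1) := by rw [mul_pow]; ring
      _ ≤ ‖g X‖ * (1 + T) ^ (k + 1) + M * (1 + X) ^ k * ((1 + X) * (1 + T)) ^ (k + 1) := by
          gcongr
      _ = _ := by rw [mul_pow]; ring
  -- Half of `η` is reserved for the oscillation error and half for the Riemann–Lebesgue term; the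
  -- `+ 1` in the witness avoids a zero denominator.
  obtain ⟨δ, hδ, hδ1, hδη⟩ : ∃ δ : ℝ, 0 < δ ∧ δ ≤ 1 ∧ M * κ * δ ≤ η / 2 * c₀ := by
    refine ⟨min 1 (η / 2 * c₀ / (M * κ + 1)), by positivity, min_le_left _ _, ?_⟩
    calc M * κ * min 1 (η / 2 * c₀ / (M * κ + 1))
        ≤ (M * κ + 1) * (η / 2 * c₀ / (M * κ + 1)) := by
          gcongr
          · linarith
          · exact min_le_right _ _
      _ = η / 2 * c₀ := by field_simp
  have hδi : 0 < δ⁻¹ := inv_pos.2 hδ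
  have hK' := hK.scale hδi
  obtain ⟨X, hX0, hX⟩ := hosc δ hδ hδ1
  have hRL := (tendsto_fourier_atTop (fun t => ((δ⁻¹ : ℝ) : ℂ)⁻¹ * φ (δ⁻¹⁻¹ * t)) G).norm
  rw [norm_zero] at hRL
  have hsmall : 0 < η / 2 * (c₀ * δ) := by positivity
  filter_upwards [hRL.eventually_lt_const hsmall, eventually_ge_atTop X] with x hx1 hx
  have hx0 : 0 ≤ x := hX0.trans hx
  obtain ⟨hi1, heq⟩ := H.integral_mul_kernel hB hK' hx0
  have hiK : IntegrableOn (fun T => K (δ⁻¹ * (T - x))) (Ioi 0) :=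
    (hK'.integrable.comp_sub_right x).integrableOn
  have hlow : c₀ * δ ≤ ∫ T in Ioi (0 : ℝ), K (δ⁻¹ * (T - x)) := by
    have hsub : Ioc x (x + δ) ⊆ Ioi 0 := fun T hT => hx0.trans_lt hT.1
    calc c₀ * δ = ∫ T in Ioc x (x + δ), c₀ := by
          rw [setIntegral_const, smul_eq_mul, Real.volume_real_Ioc_of_le (by linarith)]; ring
      _ ≤ ∫ T in Ioc x (x + δ), K (δ⁻¹ * (T - x)) := by
          refine setIntegral_mono_on (integrableOn_const (by simp)) (hiK.mono_set hsub)
            measurableSet_Ioc fun T hT => hcK _ ⟨?_, ?_⟩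
          · exact mul_nonneg hδi.le (by linarith [hT.1])
          · rw [inv_mul_le_iff₀ hδ]; linarith [hT.2]
      _ ≤ _ := setIntegral_mono_set hiK (Eventually.of_forall fun T => hK.nonneg _)
          hsub.eventuallyLE
  -- `g x` times the mass is the average of `g`, small by Riemann–Lebesgue, minus the average of `g
  -- T - g x`, controlled by slow oscillation.
  have hdiff : ‖g x‖ * ∫ T in Ioi (0 : ℝ), K (δ⁻¹ * (T - x)) ≤
      η / 2 * (c₀ * δ) + M * (1 + x) ^ k * (δ ^ 2 * κ) := by
    have hI := hK.integral_abs_add_mul_scale_le k hδ hδ1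
    have e1 : g x * ((∫ T in Ioi (0 : ℝ), K (δ⁻¹ * (T - x)) : ℝ) : ℂ) =
        (∫ T in Ioi (0 : ℝ), g T * (K (δ⁻¹ * (T - x)) : ℂ)) -
          ∫ T in Ioi (0 : ℝ), (g T - g x) * (K (δ⁻¹ * (T - x)) : ℂ) := by
      rw [← integral_complex_ofReal, ← integral_const_mul, ← integral_sub hi1]
      · congr 1
        ext T
        ring
      · simp only [sub_mul]
        exact hi1.sub (hiK.ofReal.const_mul (g x))
    have e2 : ‖∫ T in Ioi (0 : ℝ), (g T - g x) * (K (δ⁻¹ * (T - x)) : ℂ)‖ ≤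
        M * (1 + x) ^ k * (δ ^ 2 * κ) := by
      have hi := (hI.1.comp_sub_right x).const_mul (M * (1 + x) ^ k)
      calc ‖∫ T in Ioi (0 : ℝ), (g T - g x) * (K (δ⁻¹ * (T - x)) : ℂ)‖
          ≤ ∫ T in Ioi (0 : ℝ), M * (1 + x) ^ k *
              ((|T - x| + δ) * (1 + |T - x|) ^ k * K (δ⁻¹ * (T - x))) := by
            refine norm_integral_le_of_norm_le hi.integrableOn ?_
            filter_upwards [ae_restrict_mem measurableSet_Ioi] with T hT
            have hT' : 0 < T := hT
            rw [norm_mul, Complex.norm_real, Real.norm_of_nonneg (hK.nonneg _)]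
            refine (mul_le_mul_of_nonneg_right (hX x hx T hT'.le) (hK.nonneg _)).trans_eq ?_
            rw [mul_pow]
            ring
        _ ≤ ∫ T, M * (1 + x) ^ k *
              ((|T - x| + δ) * (1 + |T - x|) ^ k * K (δ⁻¹ * (T - x))) := by
            refine setIntegral_le_integral hi (Eventually.of_forall fun T => ?_)
            have := hK.nonneg (δ⁻¹ * (T - x))
            simp only [Pi.zero_apply]
            positivity
        _ = M * (1 + x) ^ k * ∫ u, (|u| + δ) * (1 + |u|) ^ k * K (δ⁻¹ * u) := by
            rw [integral_const_mul, integral_sub_right_eq_self fun u =>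
              (|u| + δ) * (1 + |u|) ^ k * K (δ⁻¹ * u)]
        _ ≤ _ := by
            gcongr
            exact hI.2
    have e3 : ‖g x * ((∫ T in Ioi (0 : ℝ), K (δ⁻¹ * (T - x)) : ℝ) : ℂ)‖ =
        ‖g x‖ * ∫ T in Ioi (0 : ℝ), K (δ⁻¹ * (T - x)) := by
      rw [norm_mul, Complex.norm_real, Real.norm_of_nonneg (le_trans (by positivity) hlow)]
    rw [← e3, e1, heq]
    exact (norm_sub_le _ _).trans (add_le_add hx1.le e2)
  have hone : 1 ≤ (1 + x) ^ k := one_le_pow₀ (by linarith)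
  have hfin : ‖g x‖ * (c₀ * δ) ≤ η * (1 + x) ^ k * (c₀ * δ) := by
    calc ‖g x‖ * (c₀ * δ) ≤ ‖g x‖ * ∫ T in Ioi (0 : ℝ), K (δ⁻¹ * (T - x)) := by gcongr
      _ ≤ η / 2 * (c₀ * δ) * 1 + (1 + x) ^ k * δ * (M * κ * δ) := by linarith
      _ ≤ η / 2 * (c₀ * δ) * (1 + x) ^ k + (1 + x) ^ k * δ * (η / 2 * c₀) := by gcongr
      _ = _ := by ring
  exact le_of_mul_le_mul_right hfin (by positivity)

end HasLaplaceBoundary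

/-! ### Assembly -/

theorem tendsto_sum_mul_pow_div_pow (c : ℕ → ℂ) (k : ℕ) :
    Tendsto (fun T : ℝ => (∑ j ∈ Finset.range (k + 1), c j * (T : ℂ) ^ j) / (T : ℂ) ^ k) atTop
      (𝓝 (c k)) := by
  have hlow : ∀ j ∈ Finset.range k,
      Tendsto (fun T : ℝ => c j * (T : ℂ) ^ j / (T : ℂ) ^ k) atTop (𝓝 0) := by
    intro j hj
    have h1 : Tendsto (fun T : ℝ => T ^ j / T ^ k) atTop (𝓝 0) :=
      tendsto_pow_div_pow_atTop_zero (Finset.mem_range.1 hj)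
    have h2 := ((Complex.continuous_ofReal.tendsto 0).comp h1).const_mul (c j)
    rw [Complex.ofReal_zero, mul_zero] at h2
    refine h2.congr fun T => ?_
    simp [mul_div_assoc]
  have hsum := tendsto_finsetSum (Finset.range k) hlow
  simp only [Finset.sum_const_zero] at hsum
  have htot := hsum.add_const (c k)
  rw [zero_add] at htot
  refine htot.congr' ?_
  filter_upwards [eventually_gt_atTop 0] with T hT
  have hT' : (T : ℂ) ^ k ≠ 0 := pow_ne_zero _ (by exact_mod_cast hT.ne')
  rw [Finset.sum_range_succ, add_div, Finset.sum_div, mul_div_cancel_right₀ _ hT']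

/-- Local integrability of `α` and `β` makes the derivative integrable, so the fundamental theorem
of calculus applies without continuity of `f'`. -/
theorem abs_sub_le_integral_add {f α β : ℝ → ℝ} (hα : ∀ T, 0 ≤ T → 0 ≤ α T)
    (hβ : ∀ T, 0 ≤ T → 0 ≤ β T) (hαi : ∀ b, IntegrableOn α (Icc 0 b))
    (hβi : ∀ b, IntegrableOn β (Icc 0 b))
    (hf : ∀ T, 0 ≤ T → HasDerivWithinAt f (α T - β T) (Ici 0) T) {x y : ℝ} (hx : 0 ≤ x)
    (hxy : x ≤ y) : |f y - f x| ≤ ∫ T in x..y, (α T + β T) := by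
  have h1 := intervalIntegrable_of_integrableOn_Icc hαi hx hxy
  have h2 := intervalIntegrable_of_integrableOn_Icc hβi hx hxy
  have hFTC := intervalIntegral.integral_eq_sub_of_hasDerivAt_of_le hxy
    (fun T hT => ((hf T (hx.trans hT.1)).continuousWithinAt).mono
      fun S hS => hx.trans hS.1)
    (fun T hT => (hf T (hx.trans hT.1.le)).hasDerivAt (Ici_mem_nhds (hx.trans_lt hT.1)))
    (h1.sub h2)
  rw [← hFTC, ← Real.norm_eq_abs]
  refine intervalIntegral.norm_integral_le_of_norm_le hxy ?_ (h1.add h2)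
  refine Eventually.of_forall fun T hT => ?_
  have hT0 : 0 ≤ T := hx.trans hT.1.le
  rw [Real.norm_eq_abs, abs_le]
  constructor <;> linarith [hα T hT0, hβ T hT0]

theorem IsMeromorphicLaplaceExtension.exists_hasBoundedWindows {a : ℝ → ℝ} {A : ℂ → ℂ} {k : ℕ}
    (hA : IsMeromorphicLaplaceExtension a A) (hpole : HasAtMostPoleAtZero A (k + 1))
    (ha : ∀ T, 0 ≤ T → 0 ≤ a T) : ∃ N, 0 ≤ N ∧ HasBoundedWindows a k N := by
  obtain ⟨c, G, H, -⟩ := exists_hasLaplaceBoundary_sub_polynomial hA hpole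
  exact H.exists_hasBoundedWindows ha (integrableOn_Icc_of_laplaceConvergesAt hA.1)

theorem HasBoundedWindows.add {a b : ℝ → ℝ} {k : ℕ} {M N : ℝ} (ha : HasBoundedWindows a k M)
    (hb : HasBoundedWindows b k N) (hai : ∀ b, IntegrableOn a (Icc 0 b))
    (hbi : ∀ x, IntegrableOn b (Icc 0 x)) :
    HasBoundedWindows (fun T => a T + b T) k (M + N) := by
  have hsplit : ∀ x δ, 0 ≤ x → 0 ≤ δ → ∫ T in x..x + δ, (a T + b T) =
      (∫ T in x..x + δ, a T) + ∫ T in x..x + δ, b T := fun x δ hx hδ =>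
    intervalIntegral.integral_add
      (intervalIntegrable_of_integrableOn_Icc hai hx (by linarith))
      (intervalIntegrable_of_integrableOn_Icc hbi hx (by linarith))
  refine ⟨fun x hx => ?_, fun δ hδ hδ1 => ?_⟩
  · rw [hsplit x 1 hx zero_le_one, add_mul]
    exact add_le_add (ha.1 x hx) (hb.1 x hx)
  · obtain ⟨X, hX0, hX⟩ := ha.2 δ hδ hδ1
    obtain ⟨Y, -, hY⟩ := hb.2 δ hδ hδ1
    refine ⟨max X Y, hX0.trans (le_max_left _ _), fun x hx => ?_⟩
    have hxX : X ≤ x := (le_max_left _ _).trans hx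
    rw [hsplit x δ (hX0.trans hxX) hδ.le, add_mul, add_mul]
    exact add_le_add (hX x hxX) (hY x ((le_max_right _ _).trans hx))

theorem theorem4 (k : ℕ) (f αp αm : ℝ → ℝ) (F Ap Am : ℂ → ℂ) (C : ℝ)
    (hf : ∀ T : ℝ, 0 ≤ T → 0 ≤ f T)
    (hαp : ∀ T : ℝ, 0 ≤ T → 0 ≤ αp T)
    (hαm : ∀ T : ℝ, 0 ≤ T → 0 ≤ αm T)
    (hderiv : ∀ T : ℝ, 0 ≤ T → HasDerivWithinAt f (αp T - αm T) (Ici 0) T)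
    (hF : IsMeromorphicLaplaceExtension f F)
    (hAp : IsMeromorphicLaplaceExtension αp Ap)
    (hAm : IsMeromorphicLaplaceExtension αm Am)
    (hFpole : HasUniquePoleAtZero F (k + 1))
    (hAppole : HasAtMostPoleAtZero Ap (k + 1))
    (hAmpole : HasAtMostPoleAtZero Am (k + 1))
    (hC : 0 < C)
    (hlim : Tendsto (fun z : ℂ => z ^ (k + 1) * F z) (𝓝[≠] 0) (𝓝 (C : ℂ))) :
    Tendsto (fun T : ℝ => f T / T ^ k) atTop (𝓝 (C / (k.factorial : ℝ))) := by
  have hpi := integrableOn_Icc_of_laplaceConvergesAt hAp.1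
  have hmi := integrableOn_Icc_of_laplaceConvergesAt hAm.1
  obtain ⟨N₁, hN₁, hw₁⟩ := hAp.exists_hasBoundedWindows hAppole hαp
  obtain ⟨N₂, hN₂, hw₂⟩ := hAm.exists_hasBoundedWindows hAmpole hαm
  have hw := hw₁.add hw₂ hpi hmi
  obtain ⟨c, G, H, hc⟩ :=
    exists_hasLaplaceBoundary_sub_polynomial hF ⟨hFpole.1.ge, hFpole.2⟩
  have hck : c k = ((C / k.factorial : ℝ) : ℂ) := by
    have h1 := tendsto_nhds_unique hc hlim
    have h2 : (k.factorial : ℂ) ≠ 0 := by exact_mod_cast k.factorial_ne_zero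
    push_cast
    rw [eq_div_iff h2, h1]
  set R : ℝ → ℂ := fun T => ∑ j ∈ Finset.range (k + 1), c j * (T : ℂ) ^ j with hR
  set r := ∑ j ∈ Finset.range (k + 1), ‖c j‖ * j with hr
  have hr0 : 0 ≤ r := by positivity
  have hosc : ∀ δ, 0 < δ → δ ≤ 1 → ∃ X, 0 ≤ X ∧ ∀ x, X ≤ x → ∀ T, 0 ≤ T →
      ‖((f T : ℂ) - R T) - ((f x : ℂ) - R x)‖ ≤
        (2 * (N₁ + N₂) + r) * (|T - x| + δ) * ((1 + x) * (1 + |T - x|)) ^ k := by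
    intro δ hδ hδ1
    obtain ⟨X, hX0, hX⟩ := hw.exists_oscillation_le (f := f) (add_nonneg hN₁ hN₂)
      (fun T hT => add_nonneg (hαp T hT) (hαm T hT)) (fun b => (hpi b).add (hmi b))
      (fun x y hx hxy => abs_sub_le_integral_add hαp hαm hpi hmi hderiv hx hxy) hδ hδ1
    refine ⟨X, hX0, fun x hx T hT => ?_⟩
    have hx0 : 0 ≤ x := hX0.trans hx
    have h1 := hX x hx T hT
    have h2 : ‖R T - R x‖ ≤ r * |T - x| * ((1 + x) * (1 + |T - x|)) ^ k :=
      norm_sum_mul_pow_sub_le c k hT hx0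
    have h3 : ‖(f T : ℂ) - (f x : ℂ)‖ = |f T - f x| := by
      rw [← Complex.ofReal_sub, Complex.norm_real, Real.norm_eq_abs]
    have h4 : 0 ≤ r * δ * ((1 + x) * (1 + |T - x|)) ^ k := by positivity
    calc ‖((f T : ℂ) - R T) - ((f x : ℂ) - R x)‖
        = ‖((f T : ℂ) - f x) - (R T - R x)‖ := by congr 1; ring
      _ ≤ ‖(f T : ℂ) - f x‖ + ‖R T - R x‖ := norm_sub_le _ _
      _ ≤ _ := by rw [h3]; linarith
  have hzero : Tendsto (fun T : ℝ => ((f T : ℂ) - R T) / (T : ℂ) ^ k) atTop (𝓝 0) := by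
    rw [NormedAddGroup.tendsto_nhds_zero]
    intro η hη
    -- For `T ≥ 1`, passing from `(1 + T) ^ k` to `T ^ k` costs `2 ^ k`; the remaining `1 / 2` makes
    -- the inequality strict.
    have hη' : 0 < η / 2 / 2 ^ k := by positivity
    filter_upwards [H.eventually_norm_le (by positivity) hosc hη', eventually_ge_atTop 1]
      with T hT hT1
    have hT0 : 0 < T := by linarith
    rw [norm_div, norm_pow, Complex.norm_real, Real.norm_of_nonneg hT0.le,
      div_lt_iff₀ (pow_pos hT0 k)]
    calc ‖(f T : ℂ) - R T‖ ≤ η / 2 / 2 ^ k * (1 + T) ^ k := hT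
      _ ≤ η / 2 / 2 ^ k * (2 * T) ^ k := by gcongr; linarith
      _ = η / 2 * T ^ k := by rw [mul_pow]; field_simp
      _ < η * T ^ k := by
        have := pow_pos hT0 k
        nlinarith
  have hsum := hzero.add (tendsto_sum_mul_pow_div_pow c k)
  rw [zero_add, hck] at hsum
  have hre := (Complex.continuous_re.tendsto _).comp hsum
  rw [Complex.ofReal_re] at hre
  refine hre.congr fun T => ?_
  simp only [Function.comp_apply, hR]
  rw [← add_div, sub_add_cancel, ← Complex.ofReal_pow, ← Complex.ofReal_div, Complex.ofReal_re]
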